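/- Let $d\ge 1$ and let $\Omega\subset\mathbb R^d$ be a bounded open set with Lipschitz boundary. Let $\Gamma_D\subset\partial\Omega$ be measurable with positive surface measure and $\Gamma_N=\partial\Omega\setminus\Gamma_D$. Let $f\in L^2(\Omega)$, $g\in L^2(\Gamma_N)$, and let $\mathbb A^\varepsilon$ be a measurable symmetric matrix field on $\Omega$ such that, for some $\alpha,\beta>0$, $\alpha|\xi|^2\le \mathbb A^\varepsilon(x)\xi\cdot\xi\le\beta|\xi|^2$ for a.e. $x\in\Omega$ and all $\xi\in\mathbb R^d$. Put $$V=\{v\in H^1(\Omega):\ v=0\text{ on }\Gamma_D\},\qquad B^\varepsilon(u,v)=\int_\Omega\mathbb A^\varepsilon\nabla u\cdot\nabla v,\qquad F(v)=\int_\Omega fv+\int_{\Gamma_N}gv ,$$ and let $u^\varepsilon\in V$ satisfy $B^\varepsilon(u^\varepsilon,v)=F(v)$ for all $v\in V$; write $q^\varepsilon=\mathbb A^\varepsilon\nabla u^\varepsilon$. Let $\mathcal T_H$ be a mesh of $\Omega$ (finitely many disjoint open subsets of $\Omega$ covering $\Omega$ up to a null set), and let $V_H^\varepsilon$ be a discrete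 space, i.e. any linear subspace of the broken Sobolev space $H^1(\mathcal T_H)$ (for example a conforming, $V_H^\varepsilon\subset V$, or nonconforming MsFEM space). Let $Q$ be a linear functional on $V+V_H^\varepsilon$ whose restriction to $V$ is continuous for the $H^1$ norm. Let $u_H^\varepsilon\in V_H^\varepsilon$ be arbitrary (for example the MsFEM approximation of $u^\varepsilon$, by a Galerkin or Petrov--Galerkin formulation), let $\hat u_H\in V$ be a field recovered from it ($\hat u_H=u_H^\varepsilon$ in the conforming case), and let $\hat{\tilde u}_H\in V$ be an approximation of the solution of the adjoint problem $B^\varepsilon(\tilde u^\varepsilon,v)=Q(v)$ for all $v\in V$; the estimates hold for any $\hat u_H,\hat{\tilde u}_H\in V$. Let $$\hat q_H\in\mathcal S=\Big\{p\in H(\mathrm{div},\Omega):\int_\Omega p\cdot\nabla v=F(v)\ \forall v\in V\Big\},\qquad \hat{\tilde q}_H\in\tilde{\mathcal S}=\Big\{p\in H(\mathrm{div},\Omega):\int_\Omega p\cdot\nabla v=Q(v)\ \forall v\in V\Big\}.$$ Define $\|p\|_{\mathcal F}=\big(\int_\Omega(\mathbb A^\varepsilon)^{-1}p\cdot p\big)^{1/2}$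 and $E_{CRE}(\hat u,\hat p)=\|\hat p-\mathbb A^\varepsilon\nabla\hat u\|_{\mathcal F}$, and $$\Delta Q=Q(\hat u_H-u_H^\varepsilon),\quad R^\varepsilon(v)=F(v)-B^\varepsilon(\hat u_H,v),\quad \hat q_H^{*}=\tfrac12(\hat q_H+\mathbb A^\varepsilon\nabla\hat u_H),$$ $$C_H^\varepsilon=\tfrac12\int_\Omega(\mathbb A^\varepsilon)^{-1}(\hat q_H-\mathbb A^\varepsilon\nabla\hat u_H)\cdot(\hat{\tilde q}_H-\mathbb A^\varepsilon\nabla\hat{\tilde u}_H),\qquad \overline C_H^\varepsilon=\tfrac12\int_\Omega(\mathbb A^\varepsilon)^{-1}(\hat q_H-\mathbb A^\varepsilon\nabla\hat u_H)\cdot(\hat{\tilde q}_H+\mathbb A^\varepsilon\nabla\hat{\tilde u}_H).$$ Write $E_{CRE}=E_{CRE}(\hat u_H,\hat q_H)$ and $\tilde E_{CRE}=E_{CRE}(\hat{\tilde u}_H,\hat{\tilde q}_H)$. Then $\overline C_H^\varepsilon=C_H^\varepsilon+R^\varepsilon(\hat{\tilde u}_H)$, and $$\big|Q(u^\varepsilon)-Q(u_H^\varepsilon)-\Delta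 Q-\overline C_H^\varepsilon\big|\ \le\ \|q^\varepsilon-\hat q_H^{*}\|_{\mathcal F}\,\|\hat{\tilde q}_H-\mathbb A^\varepsilon\nabla\hat{\tilde u}_H\|_{\mathcal F}\ =\ \tfrac12\,E_{CRE}\,\tilde E_{CRE}.$$ Consequently $$|Q(u^\varepsilon)-Q(u_H^\varepsilon)|\ \le\ \eta^Q:=\max_{\theta=\pm1}\Big|\Delta Q+\overline C_H^\varepsilon+\tfrac{\theta}{2}E_{CRE}\,\tilde E_{CRE}\Big| ,$$ where $\eta^Q$ involves neither $u^\varepsilon$ nor $\tilde u^\varepsilon$. -/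

import Mathlib

open MeasureTheory Filter Topology
open scoped ContDiff Gradient ENNReal NNReal

noncomputable section

namespace MsFEM

/-- The Euclidean space `ℝᵈ`. -/
abbrev Eucl (d : ℕ) : Type := EuclideanSpace ℝ (Fin d)

/-- Lebesgue measure on `Ω`. -/
abbrev vol {d : ℕ} (Ω : Set (Eucl d)) : Measure (Eucl d) :=
  volume.restrict Ω

/-- Surface measure on a part `Γ` of a boundary: the `(d-1)`-dimensional Hausdorff measure,
normalised to agree with Lebesgue measure on hyperplanes. -/
abbrev surf {d : ℕ} (Γ : Set (Eucl d)) : Measure (Eucl d) :=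
  (μHE[d - 1] : Measure (Eucl d)).restrict Γ

/-- `Ω` has a Lipschitz boundary: near each boundary point, and in a suitable direction `e`,
`Ω` is the region strictly above the graph of a Lipschitz function `γ` of the variables
orthogonal to `e`. -/
def HasLipschitzBoundary {d : ℕ} (Ω : Set (Eucl d)) : Prop :=
  ∀ x ∈ frontier Ω, ∃ (e : Eucl d) (γ : Eucl d → ℝ) (L : ℝ≥0) (r : ℝ),
    ‖e‖ = 1 ∧ 0 < r ∧ LipschitzWith L γ ∧ (∀ (y : Eucl d) (s : ℝ), γ (y + s • e) = γ y) ∧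
      ∀ y ∈ Metric.ball x r, (y ∈ Ω ↔ γ y < inner ℝ e y)

/-- Pairs (function, vector field) in `L²(Ω) × L²(Ω)ᵈ`, with the Hilbert norm
`(‖v‖² + ‖G‖²)^{1/2}`.  A (piecewise) weakly differentiable function `v` is identified with the
pair `(v, ∇v)`; the norm is then the (broken) `H¹` norm. -/
abbrev L2Pair {d : ℕ} (Ω : Set (Eucl d)) : Type :=
  WithLp 2 (Lp ℝ 2 (vol Ω) × Lp (Eucl d) 2 (vol Ω))

/-- `φ ∈ C_c^∞(K)`. -/
def IsTestFunction {d : ℕ} (K : Set (Eucl d)) (φ : Eucl d → ℝ) : Prop :=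
  ContDiff ℝ ∞ φ ∧ HasCompactSupport φ ∧ tsupport φ ⊆ K

theorem IsTestFunction.memLp {d : ℕ} {K : Set (Eucl d)} {φ : Eucl d → ℝ}
    (h : IsTestFunction K φ) (μ : Measure (Eucl d)) [IsFiniteMeasureOnCompacts μ] :
    MemLp φ 2 μ :=
  h.1.continuous.memLp_of_hasCompactSupport h.2.1

theorem continuous_gradient {d : ℕ} {φ : Eucl d → ℝ} (h : ContDiff ℝ ∞ φ) :
    Continuous (∇ φ) :=
  (InnerProductSpace.toDual ℝ (Eucl d)).symm.continuous.comp
    (h.continuous_fderiv (by simp))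

theorem IsTestFunction.memLp_gradient {d : ℕ} {K : Set (Eucl d)} {φ : Eucl d → ℝ}
    (h : IsTestFunction K φ) (μ : Measure (Eucl d)) [IsFiniteMeasureOnCompacts μ] :
    MemLp (∇ φ) 2 μ := by
  refine (continuous_gradient h.1).memLp_of_hasCompactSupport ?_
  exact (h.2.1.fderiv (𝕜 := ℝ)).comp_left (g := (InnerProductSpace.toDual ℝ (Eucl d)).symm)
    (map_zero _)

theorem integrable_smul {d : ℕ} {F : Type*} [NormedAddCommGroup F] [NormedSpace ℝ F]
    {μ : Measure (Eucl d)} {a : Eucl d → ℝ} {b : Eucl d → F}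
    (ha : MemLp a 2 μ) (hb : MemLp b 2 μ) : Integrable (fun x => a x • b x) μ :=
  memLp_one_iff_integrable.1 (hb.smul (p := 2) (q := 2) (r := 1) ha)

/-- The vector field component of the pair is the weak gradient, on the open set `K ⊆ Ω`,
of its function component: `∫ v ∇φ = - ∫ φ G` for all `φ ∈ C_c^∞(K)`. -/
def HasWeakGradientOn {d : ℕ} {Ω : Set (Eucl d)} (K : Set (Eucl d)) (v : L2Pair Ω) : Prop :=
  ∀ φ : Eucl d → ℝ, IsTestFunction K φ →
    ∫ x, v.fst x • ∇ φ x ∂(vol Ω) = - ∫ x, φ x • v.snd x ∂(vol Ω)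

/-- The broken Sobolev space `H¹(T)` of a family `T` of open subsets of `Ω` that covers `Ω` up to
a null set: square integrable functions on `Ω` whose restriction to each `K ∈ T` is in `H¹(K)`,
with square integrable piecewise gradient. -/
def brokenH1 {d : ℕ} (Ω : Set (Eucl d)) (T : Set (Set (Eucl d))) : Submodule ℝ (L2Pair Ω) where
  carrier := {v | ∀ K ∈ T, HasWeakGradientOn K v}
  zero_mem' := by
    intro K _ φ _
    have h1 : (fun x => (0 : L2Pair Ω).fst x • ∇ φ x) =ᵐ[vol Ω] fun _ => 0 := by
      filter_upwards [Lp.coeFn_zero ℝ 2 (vol Ω)] with x hx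
      rw [WithLp.zero_fst, hx, Pi.zero_apply, zero_smul]
    have h2 : (fun x => φ x • (0 : L2Pair Ω).snd x) =ᵐ[vol Ω] fun _ => 0 := by
      filter_upwards [Lp.coeFn_zero (Eucl d) 2 (vol Ω)] with x hx
      rw [WithLp.zero_snd, hx, Pi.zero_apply, smul_zero]
    rw [integral_congr_ae h1, integral_congr_ae h2]
    simp
  add_mem' := by
    intro v w hv hw K hK φ hφ
    have h1 : (fun x => (v + w).fst x • ∇ φ x) =ᵐ[vol Ω]
        fun x => v.fst x • ∇ φ x + w.fst x • ∇ φ x := by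
      filter_upwards [Lp.coeFn_add v.fst w.fst] with x hx
      rw [WithLp.add_fst, hx, Pi.add_apply, add_smul]
    have h2 : (fun x => φ x • (v + w).snd x) =ᵐ[vol Ω]
        fun x => φ x • v.snd x + φ x • w.snd x := by
      filter_upwards [Lp.coeFn_add v.snd w.snd] with x hx
      rw [WithLp.add_snd, hx, Pi.add_apply, smul_add]
    have hg := hφ.memLp_gradient (vol Ω)
    have hl := hφ.memLp (vol Ω)
    rw [integral_congr_ae h1, integral_congr_ae h2,
      integral_add (integrable_smul (Lp.memLp _) hg) (integrable_smul (Lp.memLp _) hg),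
      integral_add (integrable_smul hl (Lp.memLp _)) (integrable_smul hl (Lp.memLp _)),
      hv K hK φ hφ, hw K hK φ hφ, neg_add]
  smul_mem' := by
    intro c v hv K hK φ hφ
    have h1 : (fun x => (c • v).fst x • ∇ φ x) =ᵐ[vol Ω] fun x => c • (v.fst x • ∇ φ x) := by
      filter_upwards [Lp.coeFn_smul c v.fst] with x hx
      rw [WithLp.smul_fst, hx, Pi.smul_apply, smul_eq_mul, mul_smul]
    have h2 : (fun x => φ x • (c • v).snd x) =ᵐ[vol Ω] fun x => c • (φ x • v.snd x) := by
      filter_upwards [Lp.coeFn_smul c v.snd] with x hx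
      rw [WithLp.smul_snd, hx, Pi.smul_apply, smul_comm c]
    rw [integral_congr_ae h1, integral_congr_ae h2, integral_smul, integral_smul,
      hv K hK φ hφ, smul_neg]

/-- The Sobolev space `H¹(Ω)`. -/
def H1 {d : ℕ} (Ω : Set (Eucl d)) : Submodule ℝ (L2Pair Ω) := brokenH1 Ω {Ω}

/-- A (coarse) mesh of `Ω`: finitely many disjoint open elements that cover `Ω` up to a
null set. -/
structure IsMesh {d : ℕ} (Ω : Set (Eucl d)) (T : Set (Set (Eucl d))) : Prop where
  finite : T.Finite
  isOpen : ∀ K ∈ T, IsOpen K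
  subset : ∀ K ∈ T, K ⊆ Ω
  disjoint : T.PairwiseDisjoint id
  cover : volume (Ω \ ⋃₀ T) = 0

/-- `t` is the boundary trace of `v ∈ H¹(Ω)`: some functions, smooth on all of `ℝᵈ`, converge to
`v` in `H¹(Ω)` while their restrictions to `∂Ω` converge to `t` in `L²(∂Ω)`.  On a bounded
Lipschitz domain this is the graph of the trace operator `H¹(Ω) → L²(∂Ω)`. -/
def IsTrace {d : ℕ} {Ω : Set (Eucl d)} (v : L2Pair Ω) (t : Lp ℝ 2 (surf (frontier Ω))) : Prop :=
  ∃ φ : ℕ → Eucl d → ℝ, (∀ n, ContDiff ℝ ∞ (φ n)) ∧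
    Tendsto (fun n => eLpNorm (φ n - ⇑v.fst) 2 (vol Ω)) atTop (𝓝 0) ∧
    Tendsto (fun n => eLpNorm (∇ (φ n) - ⇑v.snd) 2 (vol Ω)) atTop (𝓝 0) ∧
    Tendsto (fun n => eLpNorm (φ n - ⇑t) 2 (surf (frontier Ω))) atTop (𝓝 0)

/-- The trace of `v` on `∂Ω` (unique on bounded Lipschitz domains). -/
def trace {d : ℕ} {Ω : Set (Eucl d)} (v : L2Pair Ω) : Lp ℝ 2 (surf (frontier Ω)) :=
  Classical.epsilon (IsTrace v)

theorem tendsto_eLpNorm_add {d : ℕ} {F : Type*} [NormedAddCommGroup F]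
    {μ : Measure (Eucl d)} {a b : ℕ → Eucl d → F} {s t r : Eucl d → F}
    (ha : ∀ n, Continuous (a n)) (hb : ∀ n, Continuous (b n))
    [SecondCountableTopology F]
    (hs : AEStronglyMeasurable s μ) (ht : AEStronglyMeasurable t μ) (hr : r =ᵐ[μ] s + t)
    (h1 : Tendsto (fun n => eLpNorm (a n - s) 2 μ) atTop (𝓝 0))
    (h2 : Tendsto (fun n => eLpNorm (b n - t) 2 μ) atTop (𝓝 0)) :
    Tendsto (fun n => eLpNorm (a n + b n - r) 2 μ) atTop (𝓝 0) := by
  have h := h1.add h2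
  rw [add_zero] at h
  refine tendsto_of_tendsto_of_tendsto_of_le_of_le tendsto_const_nhds h (fun _ => zero_le) ?_
  intro n
  have e : a n + b n - r =ᵐ[μ] (a n - s) + (b n - t) := by
    filter_upwards [hr] with x hx
    simp only [Pi.sub_apply, Pi.add_apply, hx]
    abel
  refine (eLpNorm_congr_ae e).trans_le ?_
  exact eLpNorm_add_le ((ha n).aestronglyMeasurable.sub hs)
    ((hb n).aestronglyMeasurable.sub ht) (by norm_num)

theorem tendsto_eLpNorm_smul {d : ℕ} {F : Type*} [NormedAddCommGroup F] [NormedSpace ℝ F]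
    {μ : Measure (Eucl d)} {a : ℕ → Eucl d → F} {s r : Eucl d → F} (c : ℝ)
    (hr : r =ᵐ[μ] c • s)
    (h1 : Tendsto (fun n => eLpNorm (a n - s) 2 μ) atTop (𝓝 0)) :
    Tendsto (fun n => eLpNorm (c • a n - r) 2 μ) atTop (𝓝 0) := by
  have h := ENNReal.Tendsto.const_mul (a := ‖c‖ₑ) h1 (Or.inr enorm_ne_top)
  rw [mul_zero] at h
  refine h.congr fun n => ?_
  rw [← eLpNorm_const_smul]
  refine eLpNorm_congr_ae ?_
  filter_upwards [hr] with x hx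
  simp [hx, smul_sub]

theorem IsTrace.zero {d : ℕ} {Ω : Set (Eucl d)} : IsTrace (0 : L2Pair Ω) 0 := by
  refine ⟨fun _ _ => 0, fun _ => contDiff_const, ?_, ?_, ?_⟩
  · refine tendsto_const_nhds.congr fun n => ?_
    rw [eLpNorm_congr_ae (g := 0), eLpNorm_zero]
    filter_upwards [Lp.coeFn_zero ℝ 2 (vol Ω)] with x hx
    rw [Pi.sub_apply, WithLp.zero_fst, hx]
    simp
  · refine tendsto_const_nhds.congr fun n => ?_
    rw [eLpNorm_congr_ae (g := 0), eLpNorm_zero]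
    filter_upwards [Lp.coeFn_zero (Eucl d) 2 (vol Ω)] with x hx
    have h0 : ∇ (fun _ : Eucl d => (0 : ℝ)) x = 0 := gradient_fun_const x (0 : ℝ)
    rw [Pi.sub_apply, WithLp.zero_snd, hx, h0]
    simp
  · refine tendsto_const_nhds.congr fun n => ?_
    rw [eLpNorm_congr_ae (g := 0), eLpNorm_zero]
    filter_upwards [Lp.coeFn_zero ℝ 2 (surf (frontier Ω))] with x hx
    rw [Pi.sub_apply, hx]
    simp

theorem IsTrace.add {d : ℕ} {Ω : Set (Eucl d)} {v w : L2Pair Ω}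
    {s t : Lp ℝ 2 (surf (frontier Ω))} (hv : IsTrace v s) (hw : IsTrace w t) :
    IsTrace (v + w) (s + t) := by
  obtain ⟨φ, hφ, h1, h2, h3⟩ := hv
  obtain ⟨ψ, hψ, k1, k2, k3⟩ := hw
  refine ⟨fun n => φ n + ψ n, fun n => (hφ n).add (hψ n), ?_, ?_, ?_⟩
  · exact tendsto_eLpNorm_add (fun n => (hφ n).continuous) (fun n => (hψ n).continuous)
      (Lp.aestronglyMeasurable _) (Lp.aestronglyMeasurable _) (Lp.coeFn_add v.fst w.fst) h1 k1
  · have e : ∀ n, ∇ (φ n + ψ n) = ∇ (φ n) + ∇ (ψ n) := by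
      intro n
      funext x
      simp only [gradient, Pi.add_apply]
      rw [fderiv_add ((hφ n).differentiable (by simp) x) ((hψ n).differentiable (by simp) x),
        map_add]
    simp only [e]
    exact tendsto_eLpNorm_add (fun n => continuous_gradient (hφ n))
      (fun n => continuous_gradient (hψ n))
      (Lp.aestronglyMeasurable _) (Lp.aestronglyMeasurable _) (Lp.coeFn_add v.snd w.snd) h2 k2
  · exact tendsto_eLpNorm_add (fun n => (hφ n).continuous) (fun n => (hψ n).continuous)
      (Lp.aestronglyMeasurable _) (Lp.aestronglyMeasurable _) (Lp.coeFn_add s t) h3 k3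

theorem IsTrace.smul {d : ℕ} {Ω : Set (Eucl d)} {v : L2Pair Ω}
    {s : Lp ℝ 2 (surf (frontier Ω))} (c : ℝ) (hv : IsTrace v s) :
    IsTrace (c • v) (c • s) := by
  obtain ⟨φ, hφ, h1, h2, h3⟩ := hv
  refine ⟨fun n => c • φ n, fun n => contDiff_const.smul (hφ n), ?_, ?_, ?_⟩
  · exact tendsto_eLpNorm_smul c (Lp.coeFn_smul c v.fst) h1
  · have e : ∀ n, ∇ (c • φ n) = c • ∇ (φ n) := by
      intro n
      funext x
      simp only [gradient, Pi.smul_apply]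
      rw [fderiv_const_smul ((hφ n).differentiable (by simp) x), map_smulₛₗ]
      simp
    simp only [e]
    exact tendsto_eLpNorm_smul c (Lp.coeFn_smul c v.snd) h2
  · exact tendsto_eLpNorm_smul c (Lp.coeFn_smul c s) h3

/-- Data of the diffusion problem `-∇·(A∇u) = f` in `Ω`, `u = 0` on `Γ_D`, `A∇u·n = g` on
`Γ_N = ∂Ω \ Γ_D`. -/
structure DiffusionProblem (d : ℕ) where
  /-- the domain -/
  Ω : Set (Eucl d)
  /-- the Dirichlet part of the boundary -/
  ΓD : Set (Eucl d)
  /-- the diffusion tensor -/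
  A : Eucl d → Matrix (Fin d) (Fin d) ℝ
  /-- the body loading -/
  f : Eucl d → ℝ
  /-- the traction loading -/
  g : Eucl d → ℝ
  isOpen : IsOpen Ω
  isBounded : Bornology.IsBounded Ω
  lipschitz : HasLipschitzBoundary Ω
  ΓD_subset : ΓD ⊆ frontier Ω
  ΓD_measurable : MeasurableSet ΓD
  ΓD_pos : 0 < surf (frontier Ω) ΓD
  A_measurable : ∀ i j, AEMeasurable (fun x => A x i j) (vol Ω)
  A_symm : ∀ᵐ x ∂(vol Ω), (A x).IsSymm
  A_elliptic : ∃ α β : ℝ, 0 < α ∧ 0 < β ∧ ∀ᵐ x ∂(vol Ω), ∀ ξ : Eucl d,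
    α * ‖ξ‖ ^ 2 ≤ inner ℝ (Matrix.toEuclideanLin (A x) ξ) ξ ∧
      inner ℝ (Matrix.toEuclideanLin (A x) ξ) ξ ≤ β * ‖ξ‖ ^ 2
  f_memLp : MemLp f 2 (vol Ω)
  g_memLp : MemLp g 2 (surf (frontier Ω \ ΓD))

namespace DiffusionProblem

variable {d : ℕ} (P : DiffusionProblem d)

/-- The Neumann part of the boundary. -/
def ΓN : Set (Eucl d) := frontier P.Ω \ P.ΓD

/-- `V = {v ∈ H¹(Ω) : v = 0 on Γ_D}`. -/
def V : Submodule ℝ (L2Pair P.Ω) where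
  carrier := {v | v ∈ H1 P.Ω ∧ ∃ t, IsTrace v t ∧ ∀ᵐ x ∂(surf P.ΓD), t x = 0}
  zero_mem' := by
    refine ⟨zero_mem _, 0, IsTrace.zero, ?_⟩
    filter_upwards [ae_restrict_of_ae_restrict_of_subset P.ΓD_subset
      (Lp.coeFn_zero ℝ 2 (surf (frontier P.Ω)))] with x hx
    simpa using hx
  add_mem' := by
    rintro v w ⟨hv, s, hs, hs0⟩ ⟨hw, t, ht, ht0⟩
    refine ⟨add_mem hv hw, s + t, hs.add ht, ?_⟩
    filter_upwards [hs0, ht0, ae_restrict_of_ae_restrict_of_subset P.ΓD_subset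
      (Lp.coeFn_add s t)] with x h1 h2 h3
    rw [h3, Pi.add_apply, h1, h2, add_zero]
  smul_mem' := by
    rintro c v ⟨hv, s, hs, hs0⟩
    refine ⟨(H1 P.Ω).smul_mem c hv, c • s, hs.smul c, ?_⟩
    filter_upwards [hs0, ae_restrict_of_ae_restrict_of_subset P.ΓD_subset
      (Lp.coeFn_smul c s)] with x h1 h3
    rw [h3, Pi.smul_apply, h1, smul_zero]

/-- The flux `A∇v`. -/
def flux (v : L2Pair P.Ω) : Eucl d → Eucl d :=
  fun x => Matrix.toEuclideanLin (P.A x) (v.snd x)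

/-- `B(u, v) = ∫_Ω A∇u · ∇v`. -/
def B (u v : L2Pair P.Ω) : ℝ := ∫ x, inner ℝ (P.flux u x) (v.snd x) ∂(vol P.Ω)

/-- `F(v) = ∫_Ω f v + ∫_{Γ_N} g v`. -/
def F (v : L2Pair P.Ω) : ℝ :=
  (∫ x, P.f x * v.fst x ∂(vol P.Ω)) + ∫ x, P.g x * trace v x ∂(surf P.ΓN)

/-- `u ∈ V` solves the weak problem `B(u, v) = F(v)` for all `v ∈ V`. -/
def IsWeakSolution (u : P.V) : Prop := ∀ v : P.V, P.B u v = P.F v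

/-- `H(div, Ω)`: square integrable vector fields with square integrable weak divergence `w`. -/
def Hdiv : Set (Lp (Eucl d) 2 (vol P.Ω)) :=
  {p | ∃ w : Lp ℝ 2 (vol P.Ω), ∀ φ : Eucl d → ℝ, IsTestFunction P.Ω φ →
    ∫ x, inner ℝ (p x) (∇ φ x) ∂(vol P.Ω) = - ∫ x, w x * φ x ∂(vol P.Ω)}

/-- Fluxes in `H(div, Ω)` equilibrated with a load functional `ℓ` on `V`:
`∫_Ω p · ∇v = ℓ(v)` for all `v ∈ V`. -/
def equilibrated (l : P.V → ℝ) : Set (Lp (Eucl d) 2 (vol P.Ω)) :=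
  {p | p ∈ P.Hdiv ∧ ∀ v : P.V, ∫ x, inner ℝ (p x) ((v : L2Pair P.Ω).snd x) ∂(vol P.Ω) = l v}

/-- The space `S` of equilibrated fluxes of the primal problem. -/
def S : Set (Lp (Eucl d) 2 (vol P.Ω)) := P.equilibrated fun v => P.F v

/-- The inner product `∫_Ω A⁻¹ p · r` on flux fields. -/
def fluxInner (p r : Eucl d → Eucl d) : ℝ :=
  ∫ x, inner ℝ (Matrix.toEuclideanLin (P.A x)⁻¹ (p x)) (r x) ∂(vol P.Ω)

/-- The energy norm on flux fields. -/
def fluxNorm (p : Eucl d → Eucl d) : ℝ := √(P.fluxInner p p)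

/-- The constitutive relation error `E_CRE(û, p̂)`. -/
def ECRE (u : P.V) (p : Lp (Eucl d) 2 (vol P.Ω)) : ℝ := P.fluxNorm (⇑p - P.flux u)

/-- The residual `R(v) = F(v) - B(û, v)` associated with `û`. -/
def residual (u : P.V) (v : P.V) : ℝ := P.F v - P.B u v

/-- The averaged flux `p̂* = (p̂ + A∇û)/2`. -/
def avgFlux (u : P.V) (p : Lp (Eucl d) 2 (vol P.Ω)) : Eucl d → Eucl d :=
  (1 / 2 : ℝ) • (⇑p + P.flux u)

/-- `C_H = ½ ∫_Ω A⁻¹ (q̂ - A∇û) · (q̂' - A∇û')`, a prime marking the adjoint quantities. -/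
def C (u : P.V) (q : Lp (Eucl d) 2 (vol P.Ω)) (u' : P.V) (q' : Lp (Eucl d) 2 (vol P.Ω)) : ℝ :=
  (1 / 2) * P.fluxInner (⇑q - P.flux u) (⇑q' - P.flux u')

/-- The correction term `½ ∫_Ω A⁻¹ (q̂ - A∇û) · (q̂' + A∇û')`, a prime marking the adjoint
quantities. -/
def Cbar (u : P.V) (q : Lp (Eucl d) 2 (vol P.Ω)) (u' : P.V) (q' : Lp (Eucl d) 2 (vol P.Ω)) :
    ℝ :=
  (1 / 2) * P.fluxInner (⇑q - P.flux u) (⇑q' + P.flux u')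

section Output

variable {VH : Submodule ℝ (L2Pair P.Ω)} (Q : ↥(P.V ⊔ VH) →ₗ[ℝ] ℝ)

/-- The value of the output `Q` on `V`. -/
def QV (v : P.V) : ℝ := Q (Submodule.inclusion le_sup_left v)

/-- The value of the output `Q` on the discrete space. -/
def QH (v : VH) : ℝ := Q (Submodule.inclusion le_sup_right v)

/-- The space of equilibrated fluxes of the adjoint problem. -/
def Sadj : Set (Lp (Eucl d) 2 (vol P.Ω)) := P.equilibrated (P.QV Q)

/-- `ΔQ = Q(û_H - u_H)`. -/
def DeltaQ (uhat : P.V) (uH : VH) : ℝ :=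
  Q (Submodule.inclusion le_sup_left uhat - Submodule.inclusion le_sup_right uH)

/-- `η^Q = max_{θ = ±1} |ΔQ + C̄ + (θ/2) E_CRE E_CRE'|`; it involves neither the exact primal
solution nor the exact adjoint solution. -/
def etaQ (uH : VH) (uhat : P.V) (qhat : Lp (Eucl d) 2 (vol P.Ω))
    (uhat' : P.V) (qhat' : Lp (Eucl d) 2 (vol P.Ω)) : ℝ :=
  (({1, -1} : Finset ℝ)).sup' (Finset.insert_nonempty 1 {-1}) fun θ =>
    |P.DeltaQ Q uhat uH + P.Cbar uhat qhat uhat' qhat' +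
      θ / 2 * (P.ECRE uhat qhat * P.ECRE uhat' qhat')|

end Output

end DiffusionProblem

end MsFEM

end

/-! Everything happens in the energy product `(p, r) = ∫ A⁻¹ p · r`. Pairing with a flux `A∇v` gives
`(p, A∇v) = ∫ p · ∇v` (`fluxInner_flux`). Write `q = A∇u`, `w = A∇û`, and `s`, `s'`, `w'` for the
equilibrated and adjoint fluxes. Then `q - s` is orthogonal to every flux `A∇v` with `v ∈ V`, and
`s'` represents `Q` on `V`. Hence `Q(u) - Q(û) = (q - w, s')`. Subtracting `C̄ = ½ (s - w, s' + w')`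
and using `(q, w') = (s, w')` leaves `(q - ½(s + w), s' - w')`, which Cauchy–Schwarz bounds
(`abs_fluxInner_le`). Since `q - w` and `q - s` are orthogonal, `q` lies on the sphere with diameter
`[w, s]` (Prager–Synge). Its distance to the midpoint is thus exactly `½ ‖s - w‖`. Ellipticity and
measurability of `A` make these products finite and bilinear. -/

namespace MsFEM

open scoped InnerProductSpace

/-! ### Pointwise bounds and measurability for the tensor and its inverse. -/

section Matrix

variable {d : ℕ} {M : Matrix (Fin d) (Fin d) ℝ}

theorem inner_toEuclideanLin_comm (h : M.IsSymm) (ξ η : Eucl d) :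
    ⟪Matrix.toEuclideanLin M ξ, η⟫_ℝ = ⟪ξ, Matrix.toEuclideanLin M η⟫_ℝ := by
  refine (Matrix.isSymmetric_toEuclideanLin_iff (𝕜 := ℝ)).2 ?_ ξ η
  rw [Matrix.IsHermitian, Matrix.conjTranspose_eq_transpose_of_trivial]
  exact h

/-- Symmetry upgrades a bound on the quadratic form to an operator norm bound: apply Cauchy–Schwarz
for the semidefinite form `⟪Mξ, η⟫` with `η = Mξ`. -/
theorem norm_toEuclideanLin_le {β : ℝ} (h : M.IsSymm) (hβ : 0 ≤ β)
    (h0 : ∀ ξ : Eucl d, 0 ≤ ⟪Matrix.toEuclideanLin M ξ, ξ⟫_ℝ)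
    (h1 : ∀ ξ : Eucl d, ⟪Matrix.toEuclideanLin M ξ, ξ⟫_ℝ ≤ β * ‖ξ‖ ^ 2) (ξ : Eucl d) :
    ‖Matrix.toEuclideanLin M ξ‖ ≤ β * ‖ξ‖ := by
  set η := Matrix.toEuclideanLin M ξ with hη
  rcases eq_or_lt_of_le (norm_nonneg η) with h2 | h2
  · rw [← h2]
    positivity
  have hcs := LinearMap.BilinForm.apply_mul_apply_le_of_forall_zero_le
    ((innerₗ (Eucl d)).comp (Matrix.toEuclideanLin M)) h0 ξ η
  simp only [LinearMap.comp_apply, innerₗ_apply_apply, ← hη] at hcs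
  rw [inner_toEuclideanLin_comm h η ξ, ← hη, real_inner_self_eq_norm_sq] at hcs
  have hle : ‖η‖ ^ 2 * ‖η‖ ^ 2 ≤ (β * ‖ξ‖ ^ 2) * (β * ‖η‖ ^ 2) :=
    hcs.trans (mul_le_mul (h1 ξ) (h1 η) (h0 η) (by positivity))
  have hsq : ‖η‖ ^ 2 ≤ (β * ‖ξ‖) ^ 2 := by
    refine le_of_mul_le_mul_right ?_ (pow_pos h2 2)
    linarith
  exact le_of_sq_le_sq hsq (by positivity)

/-- Coercivity makes the kernel trivial, and an injective square matrix is invertible. -/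
theorem isUnit_det_of_coercive {α : ℝ} (hα : 0 < α)
    (h : ∀ ξ : Eucl d, α * ‖ξ‖ ^ 2 ≤ ⟪Matrix.toEuclideanLin M ξ, ξ⟫_ℝ) : IsUnit M.det := by
  rw [← Matrix.isUnit_iff_isUnit_det, ← Matrix.mulVec_injective_iff_isUnit]
  intro a b hab
  have hab' : Matrix.toEuclideanLin M (WithLp.toLp 2 (a - b)) = 0 := by
    rw [Matrix.toLpLin_toLp, Matrix.toLin'_apply, Matrix.mulVec_sub]
    simp [hab]
  have h2 := h (WithLp.toLp 2 (a - b))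
  rw [hab', inner_zero_left] at h2
  have h3 : ‖WithLp.toLp 2 (a - b)‖ = 0 := by
    by_contra hne
    have : 0 < ‖WithLp.toLp 2 (a - b)‖ ^ 2 := by positivity
    nlinarith
  rw [norm_eq_zero, WithLp.toLp_eq_zero] at h3
  exact sub_eq_zero.1 h3

theorem toEuclideanLin_apply_inv (h : IsUnit M.det) (ξ : Eucl d) :
    Matrix.toEuclideanLin M (Matrix.toEuclideanLin M⁻¹ ξ) = ξ := by
  simp [Matrix.toLpLin_apply, Matrix.mulVec_mulVec, Matrix.mul_nonsing_inv M h]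

/-- Coercivity at `ξ = M⁻¹ p` reads `α ‖M⁻¹ p‖² ≤ ⟪p, M⁻¹ p⟫`; the norm bound on the inverse comes
from the same substitution. -/
theorem inner_toEuclideanLin_inv_nonneg {α : ℝ} (hα : 0 < α)
    (h : ∀ ξ : Eucl d, α * ‖ξ‖ ^ 2 ≤ ⟪Matrix.toEuclideanLin M ξ, ξ⟫_ℝ) (p : Eucl d) :
    0 ≤ ⟪Matrix.toEuclideanLin M⁻¹ p, p⟫_ℝ := by
  have h1 := h (Matrix.toEuclideanLin M⁻¹ p)
  rw [toEuclideanLin_apply_inv (isUnit_det_of_coercive hα h), real_inner_comm] at h1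
  exact le_trans (by positivity) h1

theorem norm_toEuclideanLin_inv_le {α : ℝ} (hα : 0 < α)
    (h : ∀ ξ : Eucl d, α * ‖ξ‖ ^ 2 ≤ ⟪Matrix.toEuclideanLin M ξ, ξ⟫_ℝ) (p : Eucl d) :
    ‖Matrix.toEuclideanLin M⁻¹ p‖ ≤ α⁻¹ * ‖p‖ := by
  have h1 := h (Matrix.toEuclideanLin M⁻¹ p)
  rw [toEuclideanLin_apply_inv (isUnit_det_of_coercive hα h)] at h1
  have h2 := h1.trans (real_inner_le_norm _ _)
  rw [← div_eq_inv_mul, le_div_iff₀ hα]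
  rcases eq_or_lt_of_le (norm_nonneg (Matrix.toEuclideanLin M⁻¹ p)) with h3 | h3
  · rw [← h3, zero_mul]
    positivity
  · refine le_of_mul_le_mul_right ?_ h3
    linarith

theorem aemeasurable_matrix_inv {X : Type*} [MeasurableSpace X] {μ : Measure X}
    {A : X → Matrix (Fin d) (Fin d) ℝ} (hA : ∀ i j, AEMeasurable (fun x => A x i j) μ)
    (i j : Fin d) : AEMeasurable (fun x => (A x)⁻¹ i j) μ := by
  have hdet : ∀ {B : X → Matrix (Fin d) (Fin d) ℝ},
      (∀ i j, AEMeasurable (fun x => B x i j) μ) → AEMeasurable (fun x => (B x).det) μ := by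
    intro B hB
    simp only [Matrix.det_apply]
    exact Finset.aemeasurable_fun_sum _ fun σ _ =>
      (Finset.aemeasurable_fun_prod _ fun k _ => hB _ _).const_smul _
  -- Cramer's rule: each entry is `det⁻¹` times the determinant of a matrix with one row replaced.
  -- As `0⁻¹ = 0`, singular points need no separate treatment.
  simp only [Matrix.inv_def, Matrix.smul_apply, Ring.inverse_eq_inv', smul_eq_mul,
    Matrix.adjugate_apply]
  refine (hdet hA).inv.mul (hdet fun k l => ?_)
  simp only [Matrix.updateRow_apply]
  split_ifs
  · exact aemeasurable_const
  · exact hA k l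

theorem memLp_toEuclideanLin {μ : Measure (Eucl d)} {A : Eucl d → Matrix (Fin d) (Fin d) ℝ}
    {C : ℝ} (hA : ∀ i j, AEMeasurable (fun x => A x i j) μ)
    (hC : ∀ᵐ x ∂μ, ∀ ξ : Eucl d, ‖Matrix.toEuclideanLin (A x) ξ‖ ≤ C * ‖ξ‖)
    {p : Eucl d → Eucl d} (hp : MemLp p 2 μ) :
    MemLp (fun x => Matrix.toEuclideanLin (A x) (p x)) 2 μ := by
  refine hp.of_le_mul (c := C) ?_ (hC.mono fun x hx => hx (p x))
  have hp' := hp.1.aemeasurable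
  refine AEMeasurable.aestronglyMeasurable ?_
  simp only [Matrix.toLpLin_apply]
  refine (WithLp.measurable_toLp 2 _).comp_aemeasurable (aemeasurable_pi_lambda _ fun i => ?_)
  simp only [Matrix.mulVec, dotProduct]
  refine Finset.aemeasurable_fun_sum _ fun j _ => (hA i j).mul ?_
  exact (measurable_pi_apply j).comp_aemeasurable
    ((WithLp.measurable_ofLp 2 _).comp_aemeasurable hp')

end Matrix

theorem integrable_inner_of_memLp_two {d : ℕ} {μ : Measure (Eucl d)} {p r : Eucl d → Eucl d}
    (hp : MemLp p 2 μ) (hr : MemLp r 2 μ) : Integrable (fun x => ⟪p x, r x⟫_ℝ) μ := by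
  refine (hp.norm.integrable_mul hr.norm).mono (hp.1.inner hr.1) (ae_of_all _ fun x => ?_)
  simpa using norm_inner_le_norm (𝕜 := ℝ) (p x) (r x)

/-! ### The energy product on square integrable flux fields. -/

namespace DiffusionProblem

variable {d : ℕ} (P : DiffusionProblem d)

/-- Square integrable vector fields on `Ω`, as a space of functions. -/
def L2Fields : Submodule ℝ (Eucl d → Eucl d) where
  carrier := {p | MemLp p 2 (vol P.Ω)}
  zero_mem' := MemLp.zero
  add_mem' := MemLp.add
  smul_mem' c _ hp := hp.const_smul c

theorem memLp_inv {p : Eucl d → Eucl d} (hp : MemLp p 2 (vol P.Ω)) :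
    MemLp (fun x => Matrix.toEuclideanLin (P.A x)⁻¹ (p x)) 2 (vol P.Ω) := by
  obtain ⟨α, β, hα, hβ, h⟩ := P.A_elliptic
  exact memLp_toEuclideanLin (aemeasurable_matrix_inv P.A_measurable)
    (h.mono fun x hx => norm_toEuclideanLin_inv_le hα fun ξ => (hx ξ).1) hp

theorem memLp_flux (v : L2Pair P.Ω) : MemLp (P.flux v) 2 (vol P.Ω) := by
  obtain ⟨α, β, hα, hβ, h⟩ := P.A_elliptic
  refine memLp_toEuclideanLin (C := β) P.A_measurable ?_ (Lp.memLp v.snd)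
  filter_upwards [h, P.A_symm] with x hx hs
  exact norm_toEuclideanLin_le hs hβ.le (fun ξ => le_trans (by positivity) (hx ξ).1)
    fun ξ => (hx ξ).2

theorem integrable_fluxInner {p r : Eucl d → Eucl d} (hp : MemLp p 2 (vol P.Ω))
    (hr : MemLp r 2 (vol P.Ω)) :
    Integrable (fun x => ⟪Matrix.toEuclideanLin (P.A x)⁻¹ (p x), r x⟫_ℝ) (vol P.Ω) :=
  integrable_inner_of_memLp_two (P.memLp_inv hp) hr

/-- The inner product on flux fields, as a bilinear form on square integrable fields. -/
noncomputable def fluxForm : LinearMap.BilinForm ℝ P.L2Fields :=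
  LinearMap.mk₂ ℝ (fun p r => P.fluxInner p r)
    (fun p p' r => by
      simp only [fluxInner, Submodule.coe_add, Pi.add_apply, map_add, inner_add_left]
      exact integral_add (P.integrable_fluxInner p.2 r.2) (P.integrable_fluxInner p'.2 r.2))
    (fun c p r => by
      simp only [fluxInner, Submodule.coe_smul, Pi.smul_apply, map_smul, real_inner_smul_left]
      exact integral_const_mul _ _)
    (fun p r r' => by
      simp only [fluxInner, Submodule.coe_add, Pi.add_apply, inner_add_right]
      exact integral_add (P.integrable_fluxInner p.2 r.2) (P.integrable_fluxInner p.2 r'.2))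
    (fun c p r => by
      simp only [fluxInner, Submodule.coe_smul, Pi.smul_apply, real_inner_smul_right]
      exact integral_const_mul _ _)

theorem fluxForm_apply (p r : P.L2Fields) : P.fluxForm p r = P.fluxInner p r := rfl

theorem fluxInner_comm (p r : Eucl d → Eucl d) : P.fluxInner p r = P.fluxInner r p := by
  refine integral_congr_ae ?_
  filter_upwards [P.A_symm] with x hs
  rw [inner_toEuclideanLin_comm (by rw [Matrix.IsSymm, Matrix.transpose_nonsing_inv, hs.eq]),
    real_inner_comm]

theorem fluxInner_self_nonneg (p : Eucl d → Eucl d) : 0 ≤ P.fluxInner p p := by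
  obtain ⟨α, β, hα, hβ, h⟩ := P.A_elliptic
  exact integral_nonneg_of_ae
    (h.mono fun x hx => inner_toEuclideanLin_inv_nonneg hα (fun ξ => (hx ξ).1) (p x))

/-- Symmetry moves `A` across the product, where it cancels `A⁻¹`. This puts both equilibrium
conditions and `B` in terms of the energy product. -/
theorem fluxInner_flux (p : Eucl d → Eucl d) (v : L2Pair P.Ω) :
    P.fluxInner p (P.flux v) = ∫ x, ⟪p x, v.snd x⟫_ℝ ∂(vol P.Ω) := by
  obtain ⟨α, β, hα, hβ, h⟩ := P.A_elliptic
  refine integral_congr_ae ?_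
  filter_upwards [h, P.A_symm] with x hx hs
  rw [flux, ← inner_toEuclideanLin_comm hs,
    toEuclideanLin_apply_inv (isUnit_det_of_coercive hα fun ξ => (hx ξ).1)]

/-- Cauchy–Schwarz needs only semidefiniteness, so fields can stay functions rather than classes
modulo null sets. -/
theorem abs_fluxInner_le {p r : Eucl d → Eucl d} (hp : MemLp p 2 (vol P.Ω))
    (hr : MemLp r 2 (vol P.Ω)) : |P.fluxInner p r| ≤ P.fluxNorm p * P.fluxNorm r := by
  have h := LinearMap.BilinForm.apply_mul_apply_le_of_forall_zero_le P.fluxForm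
    (fun s => P.fluxInner_self_nonneg s) ⟨p, hp⟩ ⟨r, hr⟩
  simp only [fluxForm_apply] at h
  rw [P.fluxInner_comm r p] at h
  rw [fluxNorm, fluxNorm, ← Real.sqrt_mul (P.fluxInner_self_nonneg p)]
  exact Real.abs_le_sqrt (by rwa [sq])

theorem fluxNorm_eq_half {p r : P.L2Fields}
    (h : P.fluxForm p p = 1 / 4 * P.fluxForm r r) :
    P.fluxNorm p = 1 / 2 * P.fluxNorm r := by
  have h' : P.fluxInner p p = (1 / 2) ^ 2 * P.fluxInner r r := by
    rw [← fluxForm_apply, ← fluxForm_apply, h]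
    norm_num
  rw [fluxNorm, fluxNorm, h', Real.sqrt_mul (by positivity), Real.sqrt_sq (by norm_num)]

end DiffusionProblem

end MsFEM

/-! ### The hypercircle argument and the bounds. -/

/-- Guaranteed goal-oriented error bounds.  `T` is the coarse mesh, `VH` the (possibly
nonconforming) discrete space, `uH` the discrete approximation, `uhat` the recovered field in `V`,
and primes mark the quantities of the adjoint problem. -/
theorem mainTheorem1 {d : ℕ} (P : MsFEM.DiffusionProblem d)
    (T : Set (Set (MsFEM.Eucl d))) (hT : MsFEM.IsMesh P.Ω T)
    (VH : Submodule ℝ (MsFEM.L2Pair P.Ω)) (hVH : VH ≤ MsFEM.brokenH1 P.Ω T)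
    (Q : ↥(P.V ⊔ VH) →ₗ[ℝ] ℝ) (hQ : Continuous (P.QV Q))
    (u : P.V) (hu : P.IsWeakSolution u)
    (uH : VH) (uhat uhat' : P.V)
    (qhat : MeasureTheory.Lp (MsFEM.Eucl d) 2 (MsFEM.vol P.Ω)) (hq : qhat ∈ P.S)
    (qhat' : MeasureTheory.Lp (MsFEM.Eucl d) 2 (MsFEM.vol P.Ω)) (hq' : qhat' ∈ P.Sadj Q) :
    P.Cbar uhat qhat uhat' qhat' = P.C uhat qhat uhat' qhat' + P.residual uhat uhat' ∧
    |P.QV Q u - P.QH Q uH - P.DeltaQ Q uhat uH - P.Cbar uhat qhat uhat' qhat'| ≤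
      P.fluxNorm (P.flux u - P.avgFlux uhat qhat) * P.fluxNorm (⇑qhat' - P.flux uhat') ∧
    P.fluxNorm (P.flux u - P.avgFlux uhat qhat) * P.fluxNorm (⇑qhat' - P.flux uhat') =
      1 / 2 * (P.ECRE uhat qhat * P.ECRE uhat' qhat') ∧
    |P.QV Q u - P.QH Q uH - P.DeltaQ Q uhat uH - P.Cbar uhat qhat uhat' qhat'| ≤
      1 / 2 * (P.ECRE uhat qhat * P.ECRE uhat' qhat') ∧
    |P.QV Q u - P.QH Q uH| ≤ P.etaQ Q uH uhat qhat uhat' qhat' := by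
  have hS : ∀ v : P.V, P.fluxInner qhat (P.flux v) = P.F v := fun v =>
    (P.fluxInner_flux _ _).trans (hq.2 v)
  have hS' : ∀ v : P.V, P.fluxInner qhat' (P.flux v) = P.QV Q v := fun v =>
    (P.fluxInner_flux _ _).trans (hq'.2 v)
  have hB : ∀ v w : P.V, P.fluxInner (P.flux v) (P.flux w) = P.B v w := fun v w =>
    P.fluxInner_flux _ _
  have hsymm : ∀ p r : P.L2Fields, P.fluxForm p r = P.fluxForm r p := fun p r =>
    P.fluxInner_comm p r
  -- `q`, `w`, `w'`, `s`, `s'` are the exact, recovered and equilibrated fluxes.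
  let q : P.L2Fields := ⟨P.flux u, P.memLp_flux u⟩
  let w : P.L2Fields := ⟨P.flux uhat, P.memLp_flux uhat⟩
  let w' : P.L2Fields := ⟨P.flux uhat', P.memLp_flux uhat'⟩
  let s : P.L2Fields := ⟨qhat, MeasureTheory.Lp.memLp qhat⟩
  let s' : P.L2Fields := ⟨qhat', MeasureTheory.Lp.memLp qhat'⟩
  -- Galerkin orthogonality: `q` and `s` balance the same load `F`.
  have hqs : ∀ v : P.V, P.fluxForm q ⟨P.flux v, P.memLp_flux v⟩ =
      P.fluxForm s ⟨P.flux v, P.memLp_flux v⟩ := fun v =>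
    (hB u v).trans ((hu v).trans (hS v).symm)
  have hqq : P.fluxForm q q = P.fluxForm s q := hqs u
  have hqw : P.fluxForm q w = P.fluxForm s w := hqs uhat
  have hqw' : P.fluxForm q w' = P.fluxForm s w' := hqs uhat'
  have hCbar : P.Cbar uhat qhat uhat' qhat' = 1 / 2 * P.fluxForm (s - w) (s' + w') := rfl
  have hC : P.C uhat qhat uhat' qhat' = 1 / 2 * P.fluxForm (s - w) (s' - w') := rfl
  have hres : P.residual uhat uhat' = P.fluxForm s w' - P.fluxForm w w' :=
    congrArg₂ (· - ·) (hS uhat').symm (hB uhat uhat').symm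
  -- `ΔQ` trades the discrete value for `Q(û)`, so only values of `Q` on `V` remain, where `s'`
  -- represents it.
  have hQe : P.QV Q u - P.QH Q uH - P.DeltaQ Q uhat uH =
      P.fluxForm s' q - P.fluxForm s' w := by
    have h1 : P.fluxForm s' q = P.QV Q u := hS' u
    have h2 : P.fluxForm s' w = P.QV Q uhat := hS' uhat
    have h3 : P.DeltaQ Q uhat uH = P.QV Q uhat - P.QH Q uH := map_sub Q _ _
    rw [h1, h2, h3]
    ring
  have hrep : P.QV Q u - P.QH Q uH - P.DeltaQ Q uhat uH - P.Cbar uhat qhat uhat' qhat' =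
      P.fluxForm (q - (1 / 2 : ℝ) • (s + w)) (s' - w') := by
    rw [hQe, hCbar, hsymm s' q, hsymm s' w]
    simp only [map_sub, map_add, map_smul, LinearMap.sub_apply, LinearMap.add_apply,
      LinearMap.smul_apply, smul_eq_mul]
    -- After expansion, `hqw'` is the only relation needed beyond algebra.
    linarith
  have hbound : |P.QV Q u - P.QH Q uH - P.DeltaQ Q uhat uH - P.Cbar uhat qhat uhat' qhat'| ≤
      P.fluxNorm (P.flux u - P.avgFlux uhat qhat) * P.fluxNorm (⇑qhat' - P.flux uhat') := by
    rw [hrep]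
    exact P.abs_fluxInner_le (q - (1 / 2 : ℝ) • (s + w)).2 (s' - w').2
  have hhalf : P.fluxNorm (P.flux u - P.avgFlux uhat qhat) = 1 / 2 * P.ECRE uhat qhat := by
    -- Prager–Synge: `hqq` and `hqw` reduce the expanded square to `¼ (s - w, s - w)`.
    refine P.fluxNorm_eq_half (p := q - (1 / 2 : ℝ) • (s + w)) (r := s - w) ?_
    have h1 := hsymm q s
    have h2 := hsymm q w
    have h3 := hsymm w s
    simp only [map_sub, map_add, map_smul, LinearMap.sub_apply, LinearMap.add_apply,
      LinearMap.smul_apply, smul_eq_mul]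
    linarith
  have heq : P.fluxNorm (P.flux u - P.avgFlux uhat qhat) * P.fluxNorm (⇑qhat' - P.flux uhat') =
      1 / 2 * (P.ECRE uhat qhat * P.ECRE uhat' qhat') := by
    rw [hhalf, mul_assoc]
    rfl
  refine ⟨?_, hbound, heq, hbound.trans_eq heq, ?_⟩
  · rw [hCbar, hC, hres]
    simp only [map_sub, map_add, LinearMap.sub_apply]
    ring
  · have hb := abs_le.1 (hbound.trans_eq heq)
    have hmax : ∀ θ ∈ ({1, -1} : Finset ℝ),
        |P.DeltaQ Q uhat uH + P.Cbar uhat qhat uhat' qhat' +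
          θ / 2 * (P.ECRE uhat qhat * P.ECRE uhat' qhat')| ≤
            P.etaQ Q uH uhat qhat uhat' qhat' := fun θ hθ =>
      Finset.le_sup' (fun θ : ℝ => |P.DeltaQ Q uhat uH + P.Cbar uhat qhat uhat' qhat' +
          θ / 2 * (P.ECRE uhat qhat * P.ECRE uhat' qhat')|) hθ
    -- The output error lies within `½ E_CRE E_CRE'` of `ΔQ + C̄`; `θ = 1` controls the upper end of
    -- this interval, `θ = -1` the lower.
    have h1 := (le_abs_self _).trans (hmax 1 (by simp))
    have h2 := (neg_le_abs _).trans (hmax (-1) (by simp))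
    rw [abs_le]
    constructor <;> linarith [hb.1, hb.2]
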